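/- For a finite alphabet $\mathcal A$ let $(\mathcal A^{\mathbb N},\sigma)$ be the one-sided full shift, $M(\mathcal A^{\mathbb N},\sigma)$ the set of shift-invariant Borel probability measures, and $h_\mu(\sigma)$ the measure-theoretic (Kolmogorov–Sinai) entropy. A Bernoulli measure is a product measure $q^{\mathbb N}$ with $q$ a probability vector on $\mathcal A$. Let $\ell_a,\ell_b\ge 1$ be integers, $X=\{1,\dots,\ell_a+\ell_b\}^{\mathbb N}$, $Y=\{a,b\}^{\mathbb N}$, and let $\pi:X\to Y$ be the 1-block factor map sending the symbols $1,\dots,\ell_a$ to $a$ and $\ell_a+1,\dots,\ell_a+\ell_b$ to $b$. For real numbers $\lambda,\psi_a,\psi_b>0$ let $\phi\equiv\lambda$ on $X$, let $\psi(y)=\psi_{y_1}$ on $Y$, and put $$P(\phi,\psi)=\sup_{\mu\in M(X,\sigma_X)}\left\{\frac{h_\mu(\sigma_X)-h_{\mu\circ\pi^{-1}}(\sigma_Y)}{\int\phi\,d\mu}+\frac{h_{\mu\circ\pi^{-1}}(\sigma_Y)}{\int\psi\circ\pi\,d\mu}\right\}.$$ Let $H(x)=-x\log x-(1-x)\log(1-x)$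 on $[0,1]$ (with $0\log 0=0$). (1) Suppose $B>2$ and $A=\max_{0\le x\le1}\left(B(x-\tfrac12)^2+H(x)\right)$, and set $$U=\sqrt{AB}-\frac B2,\qquad V=\frac{2B+4\sqrt{AB}}{4A-B},\qquad M=A-\frac B4 .$$ Let $\ell_a,\ell_b\ge1$ satisfy $\log(\ell_a/\ell_b)>\frac{1+V}{V}B$, and take $\psi_a=1+V$, $\psi_b=1$, $\lambda=\log(\ell_a/\ell_b)\,V/B$. Then $\lambda=\log(\ell_a/\ell_b)/U$; the numbers $\lambda,\psi_a,\psi_b$ are positive, $\psi_a\neq\psi_b$, and $\phi>\psi\circ\pi$ on $X$. Moreover $g(x)=Ux-M+\frac{H(x)}{1+Vx}$ satisfies $g\le0$ on $[0,1]$, and there are two distinct points of $[0,1]$ at which $g=0$ and at which $$f(x)=\frac1\lambda\left(\log(\ell_a/\ell_b)\,x+\log\ell_b\right)+\frac{H(x)}{\psi_ax+\psi_b(1-x)}$$ attains its maximum over $[0,1]$. Finally, the supremum $P(\phi,\psi)$ is finite and is attained at two distinct Bernoulli measures in $M(X,\sigma_X)$. (2) The numbers $B=3\log2$ and $A=\log3-\frac7{12}\log2$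 satisfy the assumptions of (1), the maximum defining $A$ being attained at $x=1/3$; with the corresponding $V$, the choice $\ell_a=150$, $\ell_b=1$ satisfies $\log(\ell_a/\ell_b)>\frac{1+V}{V}B$. Hence for $\psi_a=1+V$, $\psi_b=1$, $\lambda=\log150\cdot V/B$ all the conclusions of (1) hold. -/

import Mathlib

open Set Filter MeasureTheory

noncomputable section

namespace FullShift

/-! ### Measure-theoretic (Kolmogorov-Sinai) entropy

A finite measurable partition of `X` is encoded by its labelling map `ξ : X → Fin k`;
the cells are the fibres of `ξ` (empty cells contribute `0` to the entropy). -/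

section Entropy

variable {X : Type*} [MeasurableSpace X]

/-- The labelling map of the refined partition `ξ ∨ T⁻¹ ξ ∨ ⋯ ∨ T^{-(n-1)} ξ`. -/
def itinerary (T : X → X) {k : ℕ} (ξ : X → Fin k) (n : ℕ) (x : X) : Fin n → Fin k :=
  fun i => ξ (T^[i] x)

/-- Shannon entropy `H_μ(ξ ∨ T⁻¹ ξ ∨ ⋯ ∨ T^{-(n-1)} ξ) = - ∑_C μ(C) log μ(C)`,
the sum being over the cells `C` of the refined partition. -/
def partitionEntropy (μ : Measure X) (T : X → X) {k : ℕ} (ξ : X → Fin k) (n : ℕ) : ℝ :=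
  ∑ w : Fin n → Fin k, Real.negMulLog (μ.real (itinerary T ξ n ⁻¹' {w}))

/-- The entropy rate `h_μ(T, ξ) = lim_n (1/n) H_μ(ξ ∨ ⋯ ∨ T^{-(n-1)} ξ)`. For invariant
probability measures the limit exists; it is written as an upper limit here. -/
def partitionEntropyRate (μ : Measure X) (T : X → X) {k : ℕ} (ξ : X → Fin k) : ENNReal :=
  limsup (fun n : ℕ => ENNReal.ofReal (partitionEntropy μ T ξ n / n)) atTop

/-- The measure-theoretic entropy `h_μ(T)`: the supremum of `h_μ(T, ξ)` over all finite
measurable partitions `ξ`. -/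
def measureEntropy (μ : Measure X) (T : X → X) : ENNReal :=
  ⨆ (k : ℕ) (ξ : X → Fin k) (_ : Measurable ξ), partitionEntropyRate μ T ξ

end Entropy

/-! ### One-sided full shifts -/

section Shift

variable {A B : Type*}

/-- The left shift on the one-sided full shift `A^ℕ`. -/
def shift (x : ℕ → A) : ℕ → A := fun n => x (n + 1)

/-- The 1-block map `A^ℕ → B^ℕ` induced by a map of alphabets. -/
def oneBlock (p : A → B) (x : ℕ → A) : ℕ → B := fun n => p (x n)

variable [MeasurableSpace A] [MeasurableSpace B]

/-- `M(A^ℕ, σ)`: shift-invariant probability measures. (For a finite discrete alphabet the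
product σ-algebra is the Borel σ-algebra.) -/
def invariantMeasures (A : Type*) [MeasurableSpace A] : Set (Measure (ℕ → A)) :=
  {μ | IsProbabilityMeasure μ ∧ MeasurePreserving (shift (A := A)) μ μ}

/-- A Bernoulli measure: the infinite power of a probability measure on the alphabet. -/
def IsBernoulli (μ : Measure (ℕ → A)) : Prop :=
  ∃ q : ProbabilityMeasure A, μ = Measure.infinitePi (fun _ : ℕ => (q : Measure A))

/-- `(h_μ(σ_X) - h_{μ∘π⁻¹}(σ_Y)) / ∫ φ dμ + h_{μ∘π⁻¹}(σ_Y) / ∫ ψ∘π dμ`.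
Entropies of invariant measures on full shifts over finite alphabets are finite, so passing
to real numbers loses nothing. -/
def functional (π : (ℕ → A) → (ℕ → B)) (φ : (ℕ → A) → ℝ) (ψ : (ℕ → B) → ℝ)
    (μ : Measure (ℕ → A)) : ℝ :=
  ((measureEntropy μ shift).toReal - (measureEntropy (μ.map π) shift).toReal) / (∫ x, φ x ∂μ)
    + (measureEntropy (μ.map π) shift).toReal / (∫ x, ψ (π x) ∂μ)

/-- `P(φ, ψ)`: the supremum of the functional over all invariant measures. -/
def pressure (π : (ℕ → A) → (ℕ → B)) (φ : (ℕ → A) → ℝ) (ψ : (ℕ → B) → ℝ) : ℝ :=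
  sSup (functional π φ ψ '' invariantMeasures A)

/-- The supremum `P(φ, ψ)` is a genuine (finite) supremum and is attained at two distinct
Bernoulli measures. -/
def AttainedAtTwoBernoulli (π : (ℕ → A) → (ℕ → B)) (φ : (ℕ → A) → ℝ) (ψ : (ℕ → B) → ℝ) :
    Prop :=
  BddAbove (functional π φ ψ '' invariantMeasures A) ∧
  ∃ μ₁ ∈ invariantMeasures A, ∃ μ₂ ∈ invariantMeasures A,
    μ₁ ≠ μ₂ ∧ IsBernoulli μ₁ ∧ IsBernoulli μ₂ ∧
    functional π φ ψ μ₁ = pressure π φ ψ ∧ functional π φ ψ μ₂ = pressure π φ ψ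

end Shift

/-! ### The example

The alphabet `{1, …, ℓ_a + ℓ_b}` is `Fin (ℓa + ℓb)`; the alphabet `{a, b}` is `Bool`,
with `a = true` and `b = false`. -/

/-- The alphabet map: the first `ℓa` symbols go to `a`, the last `ℓb` symbols to `b`. -/
def alphabetMap (ℓa ℓb : ℕ) (i : Fin (ℓa + ℓb)) : Bool := decide ((i : ℕ) < ℓa)

/-- The 1-block factor map `π : {1, …, ℓ_a + ℓ_b}^ℕ → {a, b}^ℕ`. -/
def factorMap (ℓa ℓb : ℕ) : (ℕ → Fin (ℓa + ℓb)) → (ℕ → Bool) := oneBlock (alphabetMap ℓa ℓb)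

/-- The constant potential `φ ≡ lam`. -/
def phi (ℓa ℓb : ℕ) (lam : ℝ) (_ : ℕ → Fin (ℓa + ℓb)) : ℝ := lam

/-- The potential equal to `ψa` on the cylinder `[a]` and to `ψb` on the cylinder `[b]`. -/
def psi (ψa ψb : ℝ) (y : ℕ → Bool) : ℝ := if y 0 = true then ψa else ψb

/-- `U = √(AB) - B/2`. -/
def paramU (A B : ℝ) : ℝ := √(A * B) - B / 2

/-- `V = (2B + 4√(AB)) / (4A - B)`. -/
def paramV (A B : ℝ) : ℝ := (2 * B + 4 * √(A * B)) / (4 * A - B)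

/-- `M = A - B/4`. -/
def paramM (A B : ℝ) : ℝ := A - B / 4

/-- The admissible pairs: `B > 2` and `A = max_{0 ≤ x ≤ 1} (B (x - 1/2)² + H(x))`, where
`H(x) = -x log x - (1 - x) log (1 - x)` is the binary entropy function. -/
def Admissible (A B : ℝ) : Prop :=
  2 < B ∧ IsGreatest ((fun x : ℝ => B * (x - 1 / 2) ^ 2 + Real.binEntropy x) '' Icc 0 1) A

/-- `f(x) = (1/lam) (log(ℓ_a/ℓ_b) x + log ℓ_b) + H(x) / (ψ_a x + ψ_b (1 - x))`. -/
def fFun (ℓa ℓb : ℕ) (lam ψa ψb x : ℝ) : ℝ :=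
  1 / lam * (Real.log ((ℓa : ℝ) / ℓb) * x + Real.log ℓb) + Real.binEntropy x / (ψa * x + ψb * (1 - x))

/-- `g(x) = U x - M + H(x) / (1 + V x)`. -/
def gFun (U V M x : ℝ) : ℝ := U * x - M + Real.binEntropy x / (1 + V * x)

/-- What is asserted of the parameters `A, B, ℓ_a, ℓ_b`, with `ψ_a = 1 + V`, `ψ_b = 1` and
`lam = log(ℓ_a/ℓ_b) V / B`:
positivity of the potentials and `φ > ψ ∘ π`; two distinct maximizers in `[0, 1]` for `f`, which
are zeros of the nonpositive function `g`; and `P(φ, ψ)` is attained at two distinct Bernoulli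
measures. -/
def Conclusion (A B : ℝ) (ℓa ℓb : ℕ) (lam ψa ψb : ℝ) : Prop :=
  0 < lam ∧ 0 < ψa ∧ 0 < ψb ∧ ψa ≠ ψb ∧
  (∀ x, psi ψa ψb (factorMap ℓa ℓb x) < phi ℓa ℓb lam x) ∧
  ((∀ x ∈ Icc (0 : ℝ) 1, gFun (paramU A B) (paramV A B) (paramM A B) x ≤ 0) ∧
    ∃ x₁ ∈ Icc (0 : ℝ) 1, ∃ x₂ ∈ Icc (0 : ℝ) 1, x₁ ≠ x₂ ∧
      gFun (paramU A B) (paramV A B) (paramM A B) x₁ = 0 ∧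
      gFun (paramU A B) (paramV A B) (paramM A B) x₂ = 0 ∧
      IsMaxOn (fFun ℓa ℓb lam ψa ψb) (Icc 0 1) x₁ ∧
      IsMaxOn (fFun ℓa ℓb lam ψa ψb) (Icc 0 1) x₂) ∧
  AttainedAtTwoBernoulli (factorMap ℓa ℓb) (phi ℓa ℓb lam) (psi ψa ψb)

end FullShift

end

/-!
The functional defining the pressure only sees an invariant measure `μ` through two entropies and
the frequency `t` of the symbol `a`. The factor measure has entropy at most `H(t)`, and `μ` exceeds it in entropy by at
most `t log ℓa + (1 - t) log ℓb`, the average of the logarithm of the fibre sizes; hence the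
functional at `μ` is at most `f(t)` (`functional_le_fFun`). The Bernoulli measure whose symbols are
equidistributed over each fibre turns both bounds into equalities
(`exists_isBernoulli_functional_eq`). So the pressure is the maximum of `f` over `[0, 1]`, and two
maximizers of `f` give two Bernoulli measures, distinguished by their frequencies
(`attainedAtTwoBernoulli_of_isMaxOn`).

The entropy bounds rest on the generator theorem `measureEntropy_eq_symbolRate`: the entropy of the
shift is the entropy rate of the sequence of symbols. A finite measurable partition `ξ` agrees, off a
set of small measure, with a partition into cylinders. The `n`-words of `ξ` are therefore determined
by the `(n + N)`-words of symbols together with the `n`-words of a correction variable of small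
entropy (`exists_entropyOf_block_le`). Everything else about Shannon entropy follows from Gibbs'
inequality and from the subadditivity of `-x log x`.

On the analytic side, the parameters are such that `f - g` is constant and
`(1 + V x) g(x) = B (x - 1/2)² + H(x) - A` (`Admissible.gFun_mul`). The right-hand side is
nonpositive by the choice of `A`, symmetric about `1/2`, and vanishes somewhere. For `B > 2` it does
not vanish at `1/2`, where its second derivative is positive; so it has two zeros `x` and `1 - x`.
-/

namespace FullShift

/-! ### Shannon entropy of random variables with finitely many values -/

section Entropy

variable {S T : Type*} [Fintype S] [Fintype T]

theorem negMulLog_sum_le {ι : Type*} (s : Finset ι) (p : ι → ℝ) (hp : ∀ i ∈ s, 0 ≤ p i) :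
    Real.negMulLog (∑ i ∈ s, p i) ≤ ∑ i ∈ s, Real.negMulLog (p i) := by
  have h : Real.negMulLog (∑ i ∈ s, p i) = ∑ i ∈ s, -(p i) * Real.log (∑ j ∈ s, p j) := by
    rw [← Finset.sum_mul, Finset.sum_neg_distrib, Real.negMulLog]
  rw [h]
  refine Finset.sum_le_sum fun i hi => ?_
  rcases (hp i hi).eq_or_lt with h0 | h0
  · simp [← h0]
  · have := Real.log_le_log h0 (Finset.single_le_sum hp hi)
    rw [Real.negMulLog]
    nlinarith

/-- Gibbs' inequality. -/
theorem sum_negMulLog_le_sum_mul_neg_log (p q : S → ℝ) (hp : ∀ s, 0 ≤ p s) (hq : ∀ s, 0 ≤ q s)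
    (hpq : ∀ s, q s = 0 → p s = 0) (hsum : ∑ s, q s ≤ ∑ s, p s) :
    ∑ s, Real.negMulLog (p s) ≤ ∑ s, p s * -Real.log (q s) := by
  have key : ∀ s, Real.negMulLog (p s) ≤ p s * -Real.log (q s) + (q s - p s) := by
    intro s
    rcases (hp s).eq_or_lt with h0 | h0
    · simp [← h0, hq s]
    · have hq0 : 0 < q s := (hq s).lt_of_ne fun h => h0.ne' (hpq s h.symm)
      have h1 := Real.log_le_sub_one_of_pos (div_pos hq0 h0)
      rw [Real.log_div hq0.ne' h0.ne'] at h1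
      have h2 : p s * (Real.log (q s) - Real.log (p s)) ≤ p s * (q s / p s - 1) :=
        mul_le_mul_of_nonneg_left h1 h0.le
      have h3 : p s * (q s / p s - 1) = q s - p s := by field_simp
      rw [Real.negMulLog]
      linarith
  have := Finset.sum_le_sum fun s (_ : s ∈ Finset.univ) => key s
  rw [Finset.sum_add_distrib, Finset.sum_sub_distrib] at this
  linarith

variable {Ω Ω' : Type*} [MeasurableSpace Ω] [MeasurableSpace Ω']

/-- The Shannon entropy, in nats, of the law under `μ` of a map `f` with finitely many values. -/
noncomputable def entropyOf (μ : Measure Ω) (f : Ω → S) : ℝ :=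
  ∑ s, Real.negMulLog (μ.real (f ⁻¹' {s}))

variable [MeasurableSpace S] [MeasurableSingletonClass S]
  [MeasurableSpace T] [MeasurableSingletonClass T]

theorem entropyOf_map (μ : Measure Ω) {g : Ω → Ω'} (hg : Measurable g) {f : Ω' → S}
    (hf : Measurable f) : entropyOf (μ.map g) f = entropyOf μ (f ∘ g) := by
  unfold entropyOf
  congr! 2 with s
  rw [map_measureReal_apply hg (hf (measurableSet_singleton s)), preimage_comp]

theorem entropyOf_comp_of_measurePreserving {μ : Measure Ω} {g : Ω → Ω}
    (hg : MeasurePreserving g μ μ) {f : Ω → S} (hf : Measurable f) :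
    entropyOf μ (f ∘ g) = entropyOf μ f := by
  rw [← entropyOf_map μ hg.measurable hf, hg.map_eq]

theorem measureReal_preimage_comp {T : Type*} [DecidableEq T] (μ : Measure Ω)
    [IsFiniteMeasure μ] {f : Ω → S} (hf : Measurable f) (h : S → T) (t : T) :
    μ.real ((h ∘ f) ⁻¹' {t}) = ∑ s with h s = t, μ.real (f ⁻¹' {s}) := by
  rw [sum_measureReal_preimage_singleton _ fun s _ => hf (measurableSet_singleton s)]
  congr 1
  ext x
  simp

theorem sum_measureReal_preimage (μ : Measure Ω) [IsProbabilityMeasure μ] {f : Ω → S}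
    (hf : Measurable f) : ∑ s, μ.real (f ⁻¹' {s}) = 1 := by
  rw [sum_measureReal_preimage_singleton _ fun s _ => hf (measurableSet_singleton s)]
  simp

theorem sum_measureReal_preimage_mul (μ : Measure Ω) [IsFiniteMeasure μ] {f : Ω → S}
    (hf : Measurable f) (G : S → ℝ) :
    ∑ s, μ.real (f ⁻¹' {s}) * G s = ∫ x, G (f x) ∂μ := by
  rw [← integral_map hf.aemeasurable (measurable_of_finite G).aestronglyMeasurable,
    integral_fintype .of_finite]
  congr! 2 with s
  rw [map_measureReal_apply hf (measurableSet_singleton s)]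

/-- Data processing: a function of `f` has at most the entropy of `f`. -/
theorem entropyOf_comp_le {T : Type*} [Fintype T] (μ : Measure Ω) [IsFiniteMeasure μ]
    {f : Ω → S} (hf : Measurable f)
    (h : S → T) : entropyOf μ (h ∘ f) ≤ entropyOf μ f := by
  classical
  unfold entropyOf
  rw [← Finset.sum_fiberwise Finset.univ h]
  refine Finset.sum_le_sum fun t _ => ?_
  rw [measureReal_preimage_comp μ hf]
  exact negMulLog_sum_le _ _ fun _ _ => measureReal_nonneg

theorem entropyOf_prodMk_le (μ : Measure Ω) [IsProbabilityMeasure μ] {f : Ω → S} {g : Ω → T}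
    (hf : Measurable f) (hg : Measurable g) :
    entropyOf μ (fun x => (f x, g x)) ≤ entropyOf μ f + entropyOf μ g := by
  classical
  have hfg : Measurable fun x => (f x, g x) := hf.prodMk hg
  have hle₁ : ∀ s : S × T, μ.real ((fun x => (f x, g x)) ⁻¹' {s}) ≤ μ.real (f ⁻¹' {s.1}) :=
    fun s => measureReal_mono fun x hx => by
      have : (f x, g x) = s := hx
      simp [← this]
  have hle₂ : ∀ s : S × T, μ.real ((fun x => (f x, g x)) ⁻¹' {s}) ≤ μ.real (g ⁻¹' {s.2}) :=
    fun s => measureReal_mono fun x hx => by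
      have : (f x, g x) = s := hx
      simp [← this]
  have gibbs := sum_negMulLog_le_sum_mul_neg_log
    (fun s : S × T => μ.real ((fun x => (f x, g x)) ⁻¹' {s}))
    (fun s => μ.real (f ⁻¹' {s.1}) * μ.real (g ⁻¹' {s.2}))
    (fun _ => measureReal_nonneg) (fun _ => mul_nonneg measureReal_nonneg measureReal_nonneg)
    (fun s hs => ?_) ?_
  · refine gibbs.trans_eq ?_
    have split : ∀ s : S × T, μ.real ((fun x => (f x, g x)) ⁻¹' {s}) *
          -Real.log (μ.real (f ⁻¹' {s.1}) * μ.real (g ⁻¹' {s.2})) =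
        μ.real ((fun x => (f x, g x)) ⁻¹' {s}) * -Real.log (μ.real (f ⁻¹' {s.1})) +
        μ.real ((fun x => (f x, g x)) ⁻¹' {s}) * -Real.log (μ.real (g ⁻¹' {s.2})) := by
      intro s
      by_cases h0 : μ.real ((fun x => (f x, g x)) ⁻¹' {s}) = 0
      · simp [h0]
      · have hpos := measureReal_nonneg.lt_of_ne (Ne.symm h0)
        rw [Real.log_mul (hpos.trans_le (hle₁ s)).ne' (hpos.trans_le (hle₂ s)).ne']
        ring
    rw [Finset.sum_congr rfl fun s _ => split s, Finset.sum_add_distrib,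
      sum_measureReal_preimage_mul μ hfg fun s => -Real.log (μ.real (f ⁻¹' {s.1})),
      sum_measureReal_preimage_mul μ hfg fun s => -Real.log (μ.real (g ⁻¹' {s.2})),
      ← sum_measureReal_preimage_mul μ hf fun s => -Real.log (μ.real (f ⁻¹' {s})),
      ← sum_measureReal_preimage_mul μ hg fun s => -Real.log (μ.real (g ⁻¹' {s}))]
    simp only [entropyOf, Real.negMulLog, neg_mul, mul_neg]
  · rcases mul_eq_zero.1 hs with h | h
    · exact le_antisymm (h ▸ hle₁ s) measureReal_nonneg
    · exact le_antisymm (h ▸ hle₂ s) measureReal_nonneg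
  · rw [sum_measureReal_preimage μ hfg, Fintype.sum_prod_type]
    simp_rw [← Finset.mul_sum, sum_measureReal_preimage μ hg, mul_one]
    exact (sum_measureReal_preimage μ hf).le

/-- A bound for the conditional entropy of `f` given `h ∘ f`. The hypothesis on the weights `c`
holds in particular when `c s` is the cardinality of the fibre of `h` through `s`. -/
theorem entropyOf_le_entropyOf_comp_add [DecidableEq T] (μ : Measure Ω) [IsProbabilityMeasure μ]
    {f : Ω → S} (hf : Measurable f) (h : S → T) {c : S → ℝ} (hc : ∀ s, 0 < c s)
    (hsum : ∀ t, ∑ s with h s = t, (c s)⁻¹ ≤ 1) :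
    entropyOf μ f ≤ entropyOf μ (h ∘ f) + ∫ x, Real.log (c (f x)) ∂μ := by
  have hhf : Measurable (h ∘ f) := (measurable_of_finite h).comp hf
  have hle : ∀ s, μ.real (f ⁻¹' {s}) ≤ μ.real ((h ∘ f) ⁻¹' {h s}) :=
    fun s => measureReal_mono fun x hx => by
      have : f x = s := hx
      simp [← this]
  have gibbs := sum_negMulLog_le_sum_mul_neg_log (fun s => μ.real (f ⁻¹' {s}))
    (fun s => μ.real ((h ∘ f) ⁻¹' {h s}) * (c s)⁻¹)
    (fun _ => measureReal_nonneg)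
    (fun s => mul_nonneg measureReal_nonneg (inv_nonneg.2 (hc s).le)) (fun s hs => ?_) ?_
  · refine gibbs.trans_eq ?_
    have split : ∀ s, μ.real (f ⁻¹' {s}) *
          -Real.log (μ.real ((h ∘ f) ⁻¹' {h s}) * (c s)⁻¹) =
        μ.real (f ⁻¹' {s}) * -Real.log (μ.real ((h ∘ f) ⁻¹' {h s})) +
        μ.real (f ⁻¹' {s}) * Real.log (c s) := by
      intro s
      by_cases h0 : μ.real (f ⁻¹' {s}) = 0
      · simp [h0]
      · have hpos := measureReal_nonneg.lt_of_ne (Ne.symm h0)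
        rw [Real.log_mul (hpos.trans_le (hle s)).ne' (inv_pos.2 (hc s)).ne', Real.log_inv]
        ring
    rw [Finset.sum_congr rfl fun s _ => split s, Finset.sum_add_distrib,
      sum_measureReal_preimage_mul μ hf fun s => -Real.log (μ.real ((h ∘ f) ⁻¹' {h s})),
      sum_measureReal_preimage_mul μ hf fun s => Real.log (c s)]
    congr 1
    refine (sum_measureReal_preimage_mul μ hhf
      fun t => -Real.log (μ.real ((h ∘ f) ⁻¹' {t}))).symm.trans ?_
    simp only [entropyOf, Real.negMulLog, neg_mul, mul_neg]
  · rcases mul_eq_zero.1 hs with h' | h'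
    · exact le_antisymm (h' ▸ hle s) measureReal_nonneg
    · exact absurd h' (inv_pos.2 (hc s)).ne'
  · rw [sum_measureReal_preimage μ hf, ← Finset.sum_fiberwise Finset.univ h,
      ← sum_measureReal_preimage μ hhf]
    refine Finset.sum_le_sum fun t _ => ?_
    calc ∑ s with h s = t, μ.real ((h ∘ f) ⁻¹' {h s}) * (c s)⁻¹
        = ∑ s with h s = t, μ.real ((h ∘ f) ⁻¹' {t}) * (c s)⁻¹ := by
          refine Finset.sum_congr rfl fun s hs => ?_
          rw [(Finset.mem_filter.1 hs).2]
      _ = μ.real ((h ∘ f) ⁻¹' {t}) * ∑ s with h s = t, (c s)⁻¹ := by rw [Finset.mul_sum]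
      _ ≤ μ.real ((h ∘ f) ⁻¹' {t}) := mul_le_of_le_one_right measureReal_nonneg (hsum t)

theorem entropyOf_bool (μ : Measure Ω) [IsProbabilityMeasure μ] {f : Ω → Bool}
    (hf : Measurable f) : entropyOf μ f = Real.binEntropy (μ.real (f ⁻¹' {true})) := by
  have h := sum_measureReal_preimage μ hf
  rw [Fintype.sum_bool] at h
  rw [entropyOf, Fintype.sum_bool, Real.binEntropy_eq_negMulLog_add_negMulLog_one_sub,
    ← h, add_sub_cancel_left]

end Entropy

/-! ### Block entropies and the generator theorem for full shifts -/

section Block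

variable {X S R : Type*}

/-- The `n`-block `(f x, f (T x), …, f (T^{n-1} x))` of a labelling `f` with arbitrary labels. -/
def block (T : X → X) (f : X → S) (n : ℕ) (x : X) : Fin n → S := fun i => f (T^[i] x)

theorem shift_iterate_apply (i n : ℕ) (x : ℕ → S) : shift^[i] x n = x (n + i) := by
  induction i generalizing x with
  | zero => rfl
  | succ i ih => rw [Function.iterate_succ_apply, ih]; rfl

theorem block_shift_apply (n : ℕ) (x : ℕ → S) (i : Fin n) :
    block shift (fun x : ℕ → S => x 0) n x i = x i := by
  simp [block, shift_iterate_apply]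

variable [MeasurableSpace X] [MeasurableSpace S] [MeasurableSpace R]

theorem measurable_shift : Measurable (shift (A := S)) :=
  measurable_pi_lambda _ fun n => measurable_pi_apply (n + 1)

theorem measurable_block {T : X → X} (hT : Measurable T) {f : X → S} (hf : Measurable f) (n : ℕ) :
    Measurable (block T f n) :=
  measurable_pi_lambda _ fun i => hf.comp (hT.iterate i)

variable [Fintype S] [MeasurableSingletonClass S] [Fintype R] [MeasurableSingletonClass R]

theorem entropyOf_block_add_le {μ : Measure X} [IsProbabilityMeasure μ] {T : X → X}
    (hT : MeasurePreserving T μ μ) {f : X → S} (hf : Measurable f) (m n : ℕ) :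
    entropyOf μ (block T f (m + n)) ≤ entropyOf μ (block T f m) + entropyOf μ (block T f n) := by
  have hm := measurable_block hT.measurable hf m
  have hn := measurable_block hT.measurable hf n
  have hTm := hT.iterate m
  have split : block T f (m + n) = (fun p : (Fin m → S) × (Fin n → S) => Fin.append p.1 p.2) ∘
      fun x => (block T f m x, (block T f n ∘ T^[m]) x) := by
    ext x i
    refine Fin.addCases (fun i => ?_) (fun i => ?_) i
    · simp [block]
    · simp [block, ← Function.iterate_add_apply, add_comm]
  rw [← entropyOf_comp_of_measurePreserving hTm hn, split]
  exact (entropyOf_comp_le μ (hm.prodMk (hn.comp hTm.measurable)) _).trans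
    (entropyOf_prodMk_le μ hm (hn.comp hTm.measurable))

theorem entropyOf_block_le {μ : Measure X} [IsProbabilityMeasure μ] {T : X → X}
    (hT : MeasurePreserving T μ μ) {f : X → S} (hf : Measurable f) (n : ℕ) :
    entropyOf μ (block T f n) ≤ n * entropyOf μ f := by
  induction n with
  | zero =>
    have h : ∀ s : Fin 0 → S, block T f 0 ⁻¹' {s} = univ :=
      fun s => eq_univ_of_forall fun x => Subsingleton.elim _ _
    simp [entropyOf, h]
  | succ n ih =>
    have hone : block T f 1 = (fun s _ => s) ∘ f := by
      ext x i
      simp [block, Fin.fin_one_eq_zero i]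
    have h1 : entropyOf μ (block T f 1) ≤ entropyOf μ f := hone ▸ entropyOf_comp_le μ hf _
    have h2 := entropyOf_block_add_le hT hf n 1
    push_cast
    linarith

/-- If `ξ` is a function of an `N`-block of `f` and of a correction variable `Z`, then the `n`-words
of `ξ` are determined by the `(n + N)`-words of `f` and the `n`-words of `Z`. -/
theorem entropyOf_block_le_add_of_eq {μ : Measure X} [IsProbabilityMeasure μ] {T : X → X}
    (hT : MeasurePreserving T μ μ) {f : X → S} (hf : Measurable f) {Z : X → R}
    (hZ : Measurable Z) {Q : Type*} [Fintype Q] (ξ : X → Q) (N : ℕ) (G : (Fin N → S) → R → Q)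
    (hG : ∀ x, ξ x = G (block T f N x) (Z x)) (n : ℕ) :
    entropyOf μ (block T ξ n) ≤
      entropyOf μ (block T f n) + entropyOf μ (block T f N) + n * entropyOf μ Z := by
  have split : block T ξ n = (fun p : (Fin (n + N) → S) × (Fin n → R) => fun i : Fin n =>
        G (fun j : Fin N => p.1 ⟨i + j, by omega⟩) (p.2 i)) ∘
      fun x => (block T f (n + N) x, block T Z n x) := by
    ext x i
    have hshift : block T f N (T^[i] x) = fun j : Fin N => f (T^[i + j] x) := by
      ext j
      rw [add_comm, Function.iterate_add_apply]
      rfl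
    change ξ (T^[i] x) = _
    rw [hG, hshift]
    rfl
  have hf' := measurable_block hT.measurable hf (n + N)
  have hZ' := measurable_block hT.measurable hZ n
  rw [split]
  have h1 := entropyOf_comp_le μ (hf'.prodMk hZ')
    (fun p : (Fin (n + N) → S) × (Fin n → R) => fun i : Fin n =>
        G (fun j : Fin N => p.1 ⟨i + j, by omega⟩) (p.2 i))
  have h2 := entropyOf_prodMk_le μ hf' hZ'
  have h3 := entropyOf_block_add_le hT hf n N
  have h4 := entropyOf_block_le hT hZ n
  linarith

end Block

section Generator

variable {A : Type*} [MeasurableSpace A]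

/-- A finite measurable partition of a full shift is approximated in measure by partitions
into cylinders. -/
theorem exists_cylinder_labelling (μ : Measure (ℕ → A)) [IsProbabilityMeasure μ] {m : ℕ}
    {ξ : (ℕ → A) → Fin m} (hξ : Measurable ξ) {δ : ENNReal} (hδ : δ ≠ 0) :
    ∃ (N : ℕ) (g : (Fin N → A) → Fin m), μ {x | g (fun i => x i) ≠ ξ x} ≤ δ := by
  classical
  obtain ⟨x₀⟩ : Nonempty (ℕ → A) := nonempty_of_isProbabilityMeasure μ
  have approx : ∀ j : Fin m, ∃ t ∈ measurableCylinders (fun _ : ℕ => A),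
      μ (symmDiff t (ξ ⁻¹' {j})) < δ / m := fun j =>
    exists_measure_symmDiff_lt_of_generateFrom_isSetRing isSetRing_measurableCylinders
      ⟨{univ}, countable_singleton _, by
        simpa using univ_mem_measurableCylinders (fun _ : ℕ => A), by simp⟩
      generateFrom_measurableCylinders.symm (hξ (measurableSet_singleton j))
      (ENNReal.div_pos hδ (ENNReal.natCast_ne_top m))
  choose t ht hμt using approx
  simp only [measurableCylinders_nat, mem_iUnion, mem_singleton_iff] at ht
  choose a D _ ht using ht
  let N := Finset.univ.sup a + 1
  let extend : (Fin N → A) → ℕ → A := fun w i => if h : i < N then w ⟨i, h⟩ else x₀ i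
  have mem_iff : ∀ j x, extend (fun i => x i) ∈ t j ↔ x ∈ t j := by
    intro j x
    have : (Finset.Iic (a j)).restrict (extend fun i => x i) = (Finset.Iic (a j)).restrict x := by
      ext ⟨i, hi⟩
      have h1 : a j ≤ Finset.univ.sup a := Finset.le_sup (Finset.mem_univ j)
      have h2 : i < N := by
        have := Finset.mem_Iic.1 hi
        omega
      simp [extend, h2]
    rw [ht, mem_cylinder, mem_cylinder, this]
  refine ⟨N, fun w => if h : ∃ j, extend w ∈ t j then h.choose else ξ x₀, ?_⟩
  have sub : {x | (if h : ∃ j, extend (fun i => x i) ∈ t j then h.choose else ξ x₀) ≠ ξ x} ⊆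
      ⋃ j, symmDiff (t j) (ξ ⁻¹' {j}) := by
    intro x hx
    by_contra hnot
    have key : ∀ j, x ∈ t j ↔ ξ x = j := by
      intro j
      have := fun h => hnot (mem_iUnion.2 ⟨j, h⟩)
      rw [mem_symmDiff] at this
      simp only [mem_preimage, mem_singleton_iff] at this
      tauto
    refine hx ?_
    have hex : ∃ j, extend (fun i => x i) ∈ t j := ⟨ξ x, (mem_iff _ x).2 ((key _).2 rfl)⟩
    rw [dif_pos hex]
    exact ((key _).1 ((mem_iff _ x).1 hex.choose_spec)).symm
  calc _ ≤ μ (⋃ j, symmDiff (t j) (ξ ⁻¹' {j})) := measure_mono sub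
    _ ≤ ∑ j, μ (symmDiff (t j) (ξ ⁻¹' {j})) := measure_iUnion_fintype_le μ _
    _ ≤ ∑ _j : Fin m, δ / m := Finset.sum_le_sum fun j _ => (hμt j).le
    _ = m * (δ / m) := by simp
    _ ≤ δ := ENNReal.mul_div_le

theorem exists_forall_negMulLog_le {ε : ℝ} (hε : 0 < ε) :
    ∃ δ > 0, ∀ p, 0 ≤ p → p ≤ δ → Real.negMulLog p ≤ ε ∧ Real.negMulLog (1 - p) ≤ ε := by
  obtain ⟨δ, hδ, h⟩ := Metric.continuous_iff.1 Real.continuous_negMulLog 0 ε hε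
  refine ⟨min (min (δ / 2) ε) 1, by positivity, fun p h0 hp => ⟨?_, ?_⟩⟩
  · have h1 : p ≤ δ / 2 := hp.trans ((min_le_left _ _).trans (min_le_left _ _))
    have := h p (by rw [Real.dist_eq, sub_zero, abs_of_nonneg h0]; linarith)
    rw [Real.dist_eq, Real.negMulLog_zero, sub_zero] at this
    exact (le_abs_self _).trans this.le
  · have h1 : p ≤ ε := hp.trans ((min_le_left _ _).trans (min_le_right _ _))
    have h2 : p ≤ 1 := hp.trans (min_le_right _ _)
    have := Real.negMulLog_le_one_sub_self (sub_nonneg.2 h2)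
    linarith

variable [Fintype A] [MeasurableSingletonClass A]

/-- Up to an arbitrarily small linear error, no finite measurable partition of a full shift has
larger block entropies than the partition according to the first symbol. -/
theorem exists_entropyOf_block_le {μ : Measure (ℕ → A)} [IsProbabilityMeasure μ]
    (hμ : MeasurePreserving shift μ μ) {m : ℕ} {ξ : (ℕ → A) → Fin m} (hξ : Measurable ξ)
    {ε : ℝ} (hε : 0 < ε) :
    ∃ C, ∀ n : ℕ, entropyOf μ (block shift ξ n) ≤
      entropyOf μ (block shift (fun x => x 0) n) + C + n * ε := by
  obtain ⟨δ, hδ, hsmall⟩ := exists_forall_negMulLog_le (ε := ε / (m + 1)) (by positivity)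
  obtain ⟨N, g, hg⟩ := exists_cylinder_labelling μ hξ (δ := ENNReal.ofReal δ) (by simpa using hδ)
  have hblock : Measurable fun (x : ℕ → A) (i : Fin N) => x i :=
    measurable_pi_lambda _ fun i => measurable_pi_apply _
  -- `Z` is `0` where the approximation is right, and otherwise records the label.
  let Z : (ℕ → A) → Fin (m + 1) := fun x => if g (fun i => x i) = ξ x then 0 else (ξ x).succ
  have hZ : Measurable Z := (measurable_of_finite fun p : (Fin N → A) × Fin m =>
    if g p.1 = p.2 then (0 : Fin (m + 1)) else p.2.succ).comp (hblock.prodMk hξ)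
  have hbad : μ.real {x | g (fun i => x i) ≠ ξ x} ≤ δ := ENNReal.toReal_le_of_le_ofReal hδ.le hg
  have hZsucc : ∀ j : Fin m, μ.real (Z ⁻¹' {j.succ}) ≤ δ := fun j =>
    (measureReal_mono fun x hx => by
      by_contra h
      have h' : g (fun i => x i) = ξ x := not_not.1 h
      have hx' : Z x = j.succ := hx
      simp only [Z, if_pos h'] at hx'
      exact (Fin.succ_ne_zero j) hx'.symm).trans hbad
  have hZzero : Z ⁻¹' {0} = {x | g (fun i => x i) ≠ ξ x}ᶜ := by
    ext x
    by_cases h : g (fun i => x i) = ξ x <;> simp [Z, h]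
  have hbadm : MeasurableSet {x | g (fun i => x i) ≠ ξ x} := by
    have := (hZ (measurableSet_singleton 0)).compl
    rwa [hZzero, compl_compl] at this
  have hent : entropyOf μ Z ≤ ε := by
    have h0 : Real.negMulLog (μ.real (Z ⁻¹' {0})) ≤ ε / (m + 1) := by
      rw [hZzero, probReal_compl_eq_one_sub hbadm]
      exact (hsmall _ measureReal_nonneg hbad).2
    have h1 : ∑ j : Fin m, Real.negMulLog (μ.real (Z ⁻¹' {j.succ})) ≤
        ∑ _j : Fin m, ε / (m + 1) :=
      Finset.sum_le_sum fun j _ => (hsmall _ measureReal_nonneg (hZsucc j)).1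
    have h2 : ∑ _j : Fin m, ε / (m + 1) = m * (ε / (m + 1)) := by simp
    have h3 : ε / (m + 1) + m * (ε / (m + 1)) = ε := by field_simp; ring
    rw [entropyOf, Fin.sum_univ_succ]
    linarith
  refine ⟨entropyOf μ (block shift (fun x => x 0) N), fun n => ?_⟩
  have := entropyOf_block_le_add_of_eq hμ (measurable_pi_apply 0) hZ ξ N
    (fun w z => Fin.cases (g w) id z) (fun x => ?_) n
  · refine this.trans ?_
    gcongr
  · have hb : block shift (fun x => x 0) N x = fun i : Fin N => x i :=
      funext fun i => block_shift_apply N x i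
    by_cases h : g (fun i => x i) = ξ x
    · simp [Z, h, hb]
    · simp [Z, h]

/-- The entropy rate `lim_n H_n / n` of the sequence of symbols, written as an upper limit. -/
noncomputable def symbolRate (μ : Measure (ℕ → A)) : ENNReal :=
  limsup (fun n : ℕ => ENNReal.ofReal (entropyOf μ (block shift (fun x => x 0) n) / n)) atTop

/-- The Kolmogorov-Sinai generator theorem for full shifts. -/
theorem measureEntropy_eq_symbolRate {μ : Measure (ℕ → A)} [IsProbabilityMeasure μ]
    (hμ : MeasurePreserving shift μ μ) : measureEntropy μ shift = symbolRate μ := by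
  refine le_antisymm ?_ ?_
  · refine iSup_le fun m => iSup_le fun ξ => iSup_le fun hξ => ?_
    refine ENNReal.le_of_forall_pos_le_add fun ε hε _ => ?_
    obtain ⟨C, hC⟩ := exists_entropyOf_block_le hμ hξ (ε := ε / 2) (by positivity)
    have hlim : Tendsto (fun n : ℕ => C / (n : ℝ)) atTop (nhds 0) :=
      tendsto_const_div_atTop_nhds_zero_nat C
    have hev : ∀ᶠ n : ℕ in atTop, C / (n : ℝ) < ε / 2 :=
      hlim.eventually_lt_const (by positivity)
    have hle : partitionEntropyRate μ shift ξ ≤ limsup (fun n : ℕ => ENNReal.ofReal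
        (entropyOf μ (block shift (fun x => x 0) n) / n) + ε) atTop := by
      refine limsup_le_limsup ?_
      filter_upwards [hev, eventually_gt_atTop 0] with n hn hn0
      rw [← ENNReal.ofReal_coe_nnreal]
      refine (ENNReal.ofReal_le_ofReal ?_).trans ENNReal.ofReal_add_le
      have hn0' : (0 : ℝ) < n := by exact_mod_cast hn0
      have h1 : partitionEntropy μ shift ξ n / n ≤
          (entropyOf μ (block shift (fun x => x 0) n) + C + n * (ε / 2)) / n :=
        div_le_div_of_nonneg_right (hC n) hn0'.le
      rw [add_div, add_div, mul_div_cancel_left₀ _ hn0'.ne'] at h1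
      linarith
    refine hle.trans_eq ?_
    rw [limsup_add_const _ _ _ (by isBoundedDefault) (by isBoundedDefault)]
    rfl
  · -- the partition according to the first symbol has the symbol rate as its entropy rate
    have hξ : Measurable fun x : ℕ → A => Fintype.equivFin A (x 0) :=
      (measurable_of_finite (Fintype.equivFin A)).comp (measurable_pi_apply 0)
    refine le_trans ?_ (le_iSup_of_le (Fintype.card A) (le_iSup_of_le _ (le_iSup_of_le hξ le_rfl)))
    refine limsup_le_limsup (Eventually.of_forall fun n => ENNReal.ofReal_le_ofReal ?_)
    refine div_le_div_of_nonneg_right ?_ n.cast_nonneg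
    have h : block shift (fun x : ℕ → A => x 0) n =
        (fun w i => (Fintype.equivFin A).symm (w i)) ∘
          block shift (fun x : ℕ → A => Fintype.equivFin A (x 0)) n := by
      ext x i
      simp [block]
    rw [h]
    exact entropyOf_comp_le μ (measurable_block measurable_shift hξ n) _

theorem measureEntropy_le_entropyOf {μ : Measure (ℕ → A)} [IsProbabilityMeasure μ]
    (hμ : MeasurePreserving shift μ μ) :
    measureEntropy μ shift ≤ ENNReal.ofReal (entropyOf μ fun x => x 0) := by
  rw [measureEntropy_eq_symbolRate hμ]
  refine limsup_le_of_le (by isBoundedDefault) ?_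
  filter_upwards [eventually_gt_atTop 0] with n hn
  refine ENNReal.ofReal_le_ofReal ?_
  rw [div_le_iff₀ (by exact_mod_cast hn), mul_comm]
  exact entropyOf_block_le hμ (measurable_pi_apply 0) n

end Generator

/-! ### Entropy of one-block factors and of Bernoulli measures -/

section Factor

variable {A B : Type*} [MeasurableSpace A] [MeasurableSpace B] [Fintype A]
  [MeasurableSingletonClass A]

theorem measurable_oneBlock (p : A → B) : Measurable (oneBlock p) :=
  measurable_pi_lambda _ fun n => (measurable_of_finite p).comp (measurable_pi_apply n)

theorem measurePreserving_shift_map_oneBlock {μ : Measure (ℕ → A)}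
    (hμ : MeasurePreserving shift μ μ) (p : A → B) :
    MeasurePreserving shift (μ.map (oneBlock p)) (μ.map (oneBlock p)) := by
  refine ⟨measurable_shift, ?_⟩
  have hcomm : (shift : (ℕ → B) → ℕ → B) ∘ oneBlock p = oneBlock p ∘ shift := rfl
  rw [Measure.map_map measurable_shift (measurable_oneBlock p), hcomm,
    ← Measure.map_map (measurable_oneBlock p) measurable_shift, hμ.map_eq]

variable [Fintype B] [MeasurableSingletonClass B]

/-- If the fibres of the alphabet map `p` have weights `c`, then passing from `A^ℕ` to its factor
decreases the entropy by at most the average of `log c`. -/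
theorem measureEntropy_le_map_add [DecidableEq B] {μ : Measure (ℕ → A)} [IsProbabilityMeasure μ]
    (hμ : MeasurePreserving shift μ μ) (p : A → B) {c : A → ℝ} (hc : ∀ a, 0 < c a)
    (hsum : ∀ b, ∑ a with p a = b, (c a)⁻¹ ≤ 1) :
    measureEntropy μ shift ≤ measureEntropy (μ.map (oneBlock p)) shift +
      ENNReal.ofReal (∫ x, Real.log (c (x 0)) ∂μ) := by
  have hp := measurable_oneBlock p
  have : IsProbabilityMeasure (μ.map (oneBlock p)) :=
    Measure.isProbabilityMeasure_map hp.aemeasurable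
  rw [measureEntropy_eq_symbolRate hμ,
    measureEntropy_eq_symbolRate (measurePreserving_shift_map_oneBlock hμ p)]
  have hint : ∀ i : ℕ, ∫ x : ℕ → A, Real.log (c (x i)) ∂μ = ∫ x, Real.log (c (x 0)) ∂μ := by
    intro i
    have hm : Measurable fun x : ℕ → A => Real.log (c (x 0)) :=
      (measurable_of_finite fun a => Real.log (c a)).comp (measurable_pi_apply 0)
    conv_rhs => rw [← (hμ.iterate i).map_eq]
    rw [integral_map (hμ.iterate i).measurable.aemeasurable hm.aestronglyMeasurable]
    simp [shift_iterate_apply]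
  have hblock : ∀ n : ℕ, entropyOf μ (block shift (fun x => x 0) n) ≤
      entropyOf (μ.map (oneBlock p)) (block shift (fun x => x 0) n) +
        n * ∫ x, Real.log (c (x 0)) ∂μ := by
    intro n
    have hmA := measurable_block (measurable_shift (S := A)) (measurable_pi_apply 0) n
    have hmB := measurable_block (measurable_shift (S := B)) (measurable_pi_apply 0) n
    have hfactor : block shift (fun y : ℕ → B => y 0) n ∘ oneBlock p =
        (fun w i => p (w i)) ∘ block shift (fun x : ℕ → A => x 0) n := by
      ext x i
      simp only [Function.comp_apply, block_shift_apply]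
      rfl
    have h := entropyOf_le_entropyOf_comp_add μ hmA (fun w i => p (w i))
      (c := fun w => ∏ i, c (w i)) (fun w => Finset.prod_pos fun i _ => hc (w i)) (fun t => ?_)
    · rw [entropyOf_map μ hp hmB, hfactor]
      refine h.trans_eq ?_
      congr 1
      simp_rw [Real.log_prod fun i _ => (hc _).ne', block_shift_apply]
      rw [integral_finsetSum]
      · simp [hint]
      · intro i _
        exact ((Integrable.of_finite (μ := μ.map fun x : ℕ → A => x i)
          (f := fun a => Real.log (c a))).comp_measurable (measurable_pi_apply _))
    · -- the fibre of a word is the product of the fibres of its letters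
      have hfib : (Finset.univ.filter fun w : Fin n → A => (fun i => p (w i)) = t) =
          Fintype.piFinset fun i => Finset.univ.filter fun a => p a = t i := by
        ext w
        simp [funext_iff]
      simp_rw [hfib, ← Finset.prod_inv_distrib]
      rw [← Finset.prod_univ_sum (fun i => Finset.univ.filter fun a => p a = t i)
        fun _ a => (c a)⁻¹]
      exact Finset.prod_le_one (fun i _ => Finset.sum_nonneg fun a _ => inv_nonneg.2 (hc a).le)
        fun i _ => hsum _
  unfold symbolRate
  rw [← limsup_add_const _ _ _ (by isBoundedDefault) (by isBoundedDefault)]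
  refine limsup_le_limsup ?_
  filter_upwards [eventually_gt_atTop 0] with n hn
  refine (ENNReal.ofReal_le_ofReal ?_).trans ENNReal.ofReal_add_le
  have hn' : (0 : ℝ) < n := by exact_mod_cast hn
  rw [div_add' _ _ _ hn'.ne', mul_comm _ (n : ℝ)]
  exact div_le_div_of_nonneg_right (hblock n) hn'.le

end Factor

section Bernoulli

variable {A B : Type*} [MeasurableSpace A] [MeasurableSpace B]

theorem measurePreserving_shift_infinitePi (q : Measure A) [IsProbabilityMeasure q] :
    MeasurePreserving shift (Measure.infinitePi fun _ : ℕ => q)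
      (Measure.infinitePi fun _ : ℕ => q) := by
  refine ⟨measurable_shift, Measure.eq_infinitePi _ fun s t ht => ?_⟩
  have hpre : shift ⁻¹' (s : Set ℕ).pi t =
      ((s.map (addRightEmbedding 1) : Finset ℕ) : Set ℕ).pi fun i => t (i - 1) := by
    ext x
    simp [shift]
  rw [Measure.map_apply measurable_shift (.pi s.countable_toSet fun i _ => ht i), hpre,
    Measure.infinitePi_pi _ fun i _ => ht _]
  simp

theorem sum_negMulLog_prod {A : Type*} [Fintype A] {p : A → ℝ} (hp : ∑ a, p a = 1) (n : ℕ) :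
    ∑ w : Fin n → A, Real.negMulLog (∏ i, p (w i)) = n * ∑ a, Real.negMulLog (p a) := by
  classical
  induction n with
  | zero => simp
  | succ n ih =>
    have hone : ∑ w : Fin n → A, ∏ i, p (w i) = 1 := by
      have := Finset.prod_univ_sum (fun _ : Fin n => (Finset.univ : Finset A)) fun _ a => p a
      simpa [hp] using this.symm
    rw [← (Fin.consEquiv fun _ => A).sum_comp, Fintype.sum_prod_type]
    simp only [Fin.consEquiv_apply, Fin.prod_univ_succ, Fin.cons_zero, Fin.cons_succ,
      Real.negMulLog_mul, Finset.sum_add_distrib, ← Finset.sum_mul, ← Finset.mul_sum, ih, hone, hp]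
    push_cast
    ring

variable [Fintype A] [MeasurableSingletonClass A]

theorem measureEntropy_infinitePi (q : Measure A) [IsProbabilityMeasure q] :
    measureEntropy (Measure.infinitePi fun _ : ℕ => q) shift =
      ENNReal.ofReal (∑ a, Real.negMulLog (q.real {a})) := by
  have hone : ∑ a, q.real {a} = 1 := sum_measureReal_preimage q measurable_id
  have hblock : ∀ n : ℕ, entropyOf (Measure.infinitePi fun _ : ℕ => q)
      (block shift (fun x => x 0) n) = n * ∑ a, Real.negMulLog (q.real {a}) := by
    intro n
    rw [← sum_negMulLog_prod hone]
    refine Finset.sum_congr rfl fun w _ => ?_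
    congr 1
    have hpre : block shift (fun x : ℕ → A => x 0) n ⁻¹' {w} =
        ((Finset.range n : Finset ℕ) : Set ℕ).pi
          fun i => if h : i < n then {w ⟨i, h⟩} else univ := by
      ext x
      simp only [mem_preimage, mem_singleton_iff, funext_iff, block_shift_apply, Set.mem_pi,
        Finset.coe_range, mem_Iio, Fin.forall_iff]
      refine forall₂_congr fun i hi => ?_
      simp [hi]
    rw [hpre, Measure.real, Measure.infinitePi_pi _ fun i hi => ?_, ENNReal.toReal_prod,
      Finset.prod_range]
    · simp [Measure.real]
    · rw [dif_pos (Finset.mem_range.1 hi)]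
      exact measurableSet_singleton _
  rw [measureEntropy_eq_symbolRate (measurePreserving_shift_infinitePi q), symbolRate]
  refine Tendsto.limsup_eq (tendsto_const_nhds.congr' ?_)
  filter_upwards [eventually_gt_atTop 0] with n hn
  rw [hblock, mul_div_cancel_left₀ _ (by exact_mod_cast hn.ne')]

end Bernoulli

/-! ### The quadratic perturbation of the binary entropy -/

section Perturbation

/-- The function `B (x - 1/2)² + H(x)` whose maximum over `[0, 1]` is the parameter `A`. -/
noncomputable def perturbedEntropy (B x : ℝ) : ℝ := B * (x - 1 / 2) ^ 2 + Real.binEntropy x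

theorem perturbedEntropy_one_sub (B x : ℝ) :
    perturbedEntropy B (1 - x) = perturbedEntropy B x := by
  rw [perturbedEntropy, perturbedEntropy, Real.binEntropy_one_sub]
  ring

theorem continuous_perturbedEntropy (B : ℝ) : Continuous (perturbedEntropy B) := by
  unfold perturbedEntropy
  fun_prop

theorem hasDerivAt_perturbedEntropy (B : ℝ) {x : ℝ} (h0 : 0 < x) (h1 : x < 1) :
    HasDerivAt (perturbedEntropy B) (2 * B * (x - 1 / 2) + (Real.log (1 - x) - Real.log x)) x := by
  have h := ((((hasDerivAt_id x).sub_const (1 / 2)).pow 2).const_mul B).add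
    (Real.hasDerivAt_binEntropy h0.ne' h1.ne)
  convert! h using 1
  simp
  ring

theorem hasDerivAt_deriv_perturbedEntropy (B : ℝ) {x : ℝ} (h0 : 0 < x) (h1 : x < 1) :
    HasDerivAt (deriv (perturbedEntropy B)) (2 * B - 1 / (x * (1 - x))) x := by
  have h1' : (1 - x) ≠ 0 := (sub_pos.2 h1).ne'
  have h : HasDerivAt (fun x => 2 * B * (x - 1 / 2) + (Real.log (1 - x) - Real.log x))
      (2 * B - 1 / (x * (1 - x))) x := by
    have := (((hasDerivAt_id x).sub_const (1 / 2)).const_mul (2 * B)).add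
      ((((hasDerivAt_id x).const_sub 1).log h1').sub (Real.hasDerivAt_log h0.ne'))
    convert! this using 1
    simp only [id]
    field_simp
    ring
  refine h.congr_of_eventuallyEq ?_
  filter_upwards [Ioo_mem_nhds h0 h1] with y hy
  exact (hasDerivAt_perturbedEntropy B hy.1 hy.2).deriv

/-- For `B > 2` the point `1/2` is not a maximizer: it is a critical point at which the second
derivative is `2B - 4 > 0`. -/
theorem perturbedEntropy_half_ne {A B : ℝ} (hB : 2 < B)
    (hA : ∀ x ∈ Icc (0 : ℝ) 1, perturbedEntropy B x ≤ A) : perturbedEntropy B (1 / 2) ≠ A := by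
  intro heq
  have h2 := (hasDerivAt_deriv_perturbedEntropy B (x := 1 / 2) (by norm_num) (by norm_num)).deriv
  have h1 := (hasDerivAt_perturbedEntropy B (x := 1 / 2) (by norm_num) (by norm_num)).deriv
  have hmin : IsLocalMin (perturbedEntropy B) (1 / 2) := by
    refine isLocalMin_of_deriv_deriv_pos ?_ ?_ (continuous_perturbedEntropy B).continuousAt
    · rw [h2]
      norm_num
      linarith
    · rw [h1]
      norm_num
  -- a local minimum that is also a maximum makes the function locally constant
  have hconst : perturbedEntropy B =ᶠ[nhds (1 / 2)] fun _ => A := by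
    filter_upwards [hmin, Icc_mem_nhds (show (0 : ℝ) < 1 / 2 by norm_num)
      (show (1 / 2 : ℝ) < 1 by norm_num)] with x hx hx01
    exact le_antisymm (hA x hx01) (heq ▸ hx)
  have hzero : deriv (deriv (perturbedEntropy B)) (1 / 2) = 0 := by
    rw [hconst.deriv.deriv_eq]
    simp
  rw [h2] at hzero
  norm_num at hzero
  linarith

theorem Admissible.le {A B : ℝ} (h : Admissible A B) {x : ℝ} (hx : x ∈ Icc (0 : ℝ) 1) :
    perturbedEntropy B x ≤ A :=
  h.2.2 (mem_image_of_mem _ hx)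

theorem Admissible.exists_eq {A B : ℝ} (h : Admissible A B) :
    ∃ x ∈ Icc (0 : ℝ) 1, x ≠ 1 / 2 ∧ perturbedEntropy B x = A := by
  obtain ⟨x, hx, hxA⟩ := h.2.1
  refine ⟨x, hx, ?_, hxA⟩
  rintro rfl
  exact perturbedEntropy_half_ne h.1 (fun _ => h.le) hxA

/-- The maximum exceeds the value `B/4` at the endpoints, since `H` has infinite slope there. -/
theorem Admissible.div_four_lt {A B : ℝ} (h : Admissible A B) : B / 4 < A := by
  have hB : 0 < B := by linarith [h.1]
  -- at `x = exp (-B)` the term `-x log x` of `H` is already `B x`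
  have hx0 := Real.exp_pos (-B)
  have hx1 : Real.exp (-B) < 1 := Real.exp_lt_one_iff.mpr (by linarith)
  have hle := h.le ⟨hx0.le, hx1.le⟩
  rw [perturbedEntropy, Real.binEntropy_eq_negMulLog_add_negMulLog_one_sub] at hle
  have h1 : Real.negMulLog (Real.exp (-B)) = Real.exp (-B) * B := by
    rw [Real.negMulLog, Real.log_exp]
    ring
  have h2 : 0 ≤ Real.negMulLog (1 - Real.exp (-B)) :=
    Real.negMulLog_nonneg (by linarith) (by linarith)
  have h3 : 0 < B * Real.exp (-B) ^ 2 := by positivity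
  rw [h1] at hle
  linarith

/-- For `B = 3 log 2` the maximum is attained at `1/3`. To the left of the inflection point the
function is concave with critical point `1/3`; between there and `1/2` it is convex, and at `1/2`
its value `log 2` is smaller because `2^19 < 3^12`. -/
theorem perturbedEntropy_le_at_third {x : ℝ} (hx : x ∈ Icc (0 : ℝ) 1) :
    perturbedEntropy (3 * Real.log 2) x ≤ perturbedEntropy (3 * Real.log 2) (1 / 3) := by
  set B := 3 * Real.log 2 with hB
  have hBl : 2 < B := by linarith [Real.log_two_gt_d9]
  have hBu : B < 9 / 4 := by linarith [Real.log_two_lt_d9]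
  set r := √(1 / 4 - 1 / (2 * B)) with hr
  have hinv : 1 / (2 * B) < 1 / 4 := by
    rw [div_lt_div_iff₀ (by positivity) (by norm_num)]
    linarith
  have hinv' : 2 / 9 < 1 / (2 * B) := by
    rw [div_lt_div_iff₀ (by norm_num) (by positivity)]
    linarith
  have hr2 : r ^ 2 = 1 / 4 - 1 / (2 * B) := Real.sq_sqrt (by linarith)
  have hr0 : 0 < r := Real.sqrt_pos.2 (by linarith)
  have hr1 : r < 1 / 6 := by nlinarith
  -- the value at `1/2`
  have hhalf : perturbedEntropy B (1 / 2) ≤ perturbedEntropy B (1 / 3) := by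
    have h19 : 19 * Real.log 2 < 12 * Real.log 3 := by
      have := Real.log_lt_log (x := 2 ^ 19) (y := 3 ^ 12) (by norm_num) (by norm_num)
      rw [Real.log_pow, Real.log_pow] at this
      exact_mod_cast this
    have h2 : Real.log (1 - 1 / 3) = Real.log 2 - Real.log 3 := by
      rw [← Real.log_div (by norm_num) (by norm_num)]
      norm_num
    rw [perturbedEntropy, perturbedEntropy,
      show Real.binEntropy (1 / 2) = Real.log 2 by rw [one_div, Real.binEntropy_two_inv],
      Real.binEntropy_eq_negMulLog_add_negMulLog_one_sub, Real.negMulLog, Real.negMulLog, h2,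
      one_div (3 : ℝ), Real.log_inv]
    linarith
  have hcont : ∀ s, ContinuousOn (perturbedEntropy B) s :=
    fun _ => (continuous_perturbedEntropy B).continuousOn
  have hleft : ∀ y ∈ Icc 0 (1 / 2 - r), perturbedEntropy B y ≤ perturbedEntropy B (1 / 3) := by
    have hconc : ConcaveOn ℝ (Icc 0 (1 / 2 - r)) (perturbedEntropy B) := by
      refine concaveOn_of_deriv2_nonpos (convex_Icc _ _) (hcont _) ?_ ?_ ?_ <;>
        rw [interior_Icc] <;> intro y hy <;> have hy1 : y < 1 := by linarith [hy.2]
      · exact (hasDerivAt_perturbedEntropy B hy.1 hy1).differentiableAt.differentiableWithinAt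
      · exact (hasDerivAt_deriv_perturbedEntropy B hy.1 hy1).differentiableAt.differentiableWithinAt
      · have hpos : 0 < y * (1 - y) := mul_pos hy.1 (by linarith)
        have hle : y * (1 - y) ≤ 1 / (2 * B) := by nlinarith [hy.2]
        have := one_div_le_one_div_of_le hpos hle
        rw [one_div_one_div] at this
        rw [Function.iterate_succ_apply, Function.iterate_one,
          (hasDerivAt_deriv_perturbedEntropy B hy.1 hy1).deriv]
        linarith
    have hcrit : HasDerivAt (-perturbedEntropy B) 0 (1 / 3) := by
      have h := (hasDerivAt_perturbedEntropy B (x := 1 / 3) (by norm_num) (by norm_num)).neg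
      convert! h using 1
      rw [← Real.log_div (by norm_num) (by norm_num)]
      norm_num
      linarith
    have hmin := hconc.neg.isMinOn_of_rightDeriv_eq_zero (x := 1 / 3)
      (by rw [interior_Icc]; constructor <;> linarith)
      (hcrit.hasDerivWithinAt.derivWithin (uniqueDiffWithinAt_Ioi _))
    intro y hy
    exact neg_le_neg_iff.1 (hmin hy)
  have hright : ∀ y ∈ Icc (1 / 2 - r) (1 / 2),
      perturbedEntropy B y ≤ perturbedEntropy B (1 / 3) := by
    have hconv : ConvexOn ℝ (Icc (1 / 2 - r) (1 / 2)) (perturbedEntropy B) := by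
      refine convexOn_of_deriv2_nonneg (convex_Icc _ _) (hcont _) ?_ ?_ ?_ <;>
        rw [interior_Icc] <;> intro y hy <;>
        obtain ⟨hy0, hy1⟩ : 0 < y ∧ y < 1 := ⟨by linarith [hy.1], by linarith [hy.2]⟩
      · exact (hasDerivAt_perturbedEntropy B hy0 hy1).differentiableAt.differentiableWithinAt
      · exact (hasDerivAt_deriv_perturbedEntropy B hy0 hy1).differentiableAt.differentiableWithinAt
      · have hle : 1 / (2 * B) ≤ y * (1 - y) := by nlinarith [hy.1, hy.2]
        have := one_div_le_one_div_of_le (by positivity) hle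
        rw [one_div_one_div] at this
        rw [Function.iterate_succ_apply, Function.iterate_one,
          (hasDerivAt_deriv_perturbedEntropy B hy0 hy1).deriv]
        linarith
    intro y hy
    refine (hconv.le_max_of_mem_Icc ⟨le_rfl, by linarith⟩ ⟨by linarith, le_rfl⟩ hy).trans ?_
    exact max_le (hleft _ ⟨by linarith, le_rfl⟩) hhalf
  have hlow : ∀ y ∈ Icc (0 : ℝ) (1 / 2), perturbedEntropy B y ≤ perturbedEntropy B (1 / 3) :=
    fun y hy => (le_total y (1 / 2 - r)).elim (fun h => hleft y ⟨hy.1, h⟩)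
      fun h => hright y ⟨h, hy.2⟩
  rcases le_total x (1 / 2) with h | h
  · exact hlow x ⟨hx.1, h⟩
  · rw [← perturbedEntropy_one_sub]
    exact hlow _ ⟨by linarith [hx.2], by linarith⟩

theorem perturbedEntropy_third :
    perturbedEntropy (3 * Real.log 2) (1 / 3) = Real.log 3 - 7 / 12 * Real.log 2 := by
  have h2 : Real.log (1 - 1 / 3) = Real.log 2 - Real.log 3 := by
    rw [← Real.log_div (by norm_num) (by norm_num)]
    norm_num
  rw [perturbedEntropy, Real.binEntropy_eq_negMulLog_add_negMulLog_one_sub, Real.negMulLog,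
    Real.negMulLog, h2, one_div (3 : ℝ), Real.log_inv]
  ring

theorem admissible_three_mul_log_two :
    Admissible (Real.log 3 - 7 / 12 * Real.log 2) (3 * Real.log 2) := by
  refine ⟨by linarith [Real.log_two_gt_d9], ?_⟩
  rw [← perturbedEntropy_third]
  refine ⟨⟨1 / 3, ⟨by norm_num, by norm_num⟩, rfl⟩, ?_⟩
  rintro _ ⟨x, hx, rfl⟩
  exact perturbedEntropy_le_at_third hx

end Perturbation

/-! ### The parameters `U`, `V`, `M` -/

section Parameters

variable {A B : ℝ}

theorem Admissible.paramU_pos (h : Admissible A B) : 0 < paramU A B := by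
  have hB := h.1
  have hA := h.div_four_lt
  refine sub_pos.2 (Real.lt_sqrt_of_sq_lt ?_)
  nlinarith

theorem Admissible.paramV_pos (h : Admissible A B) : 0 < paramV A B := by
  have hB := h.1
  have hA := h.div_four_lt
  exact div_pos (by positivity) (by linarith)

theorem Admissible.paramU_mul_paramV (h : Admissible A B) : paramU A B * paramV A B = B := by
  have hB := h.1
  have hA := h.div_four_lt
  have hs : √(A * B) ^ 2 = A * B := Real.sq_sqrt (by nlinarith)
  have hne : 4 * A - B ≠ 0 := by linarith
  rw [paramU, paramV, ← mul_div_assoc, div_eq_iff hne]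
  linear_combination 4 * hs

theorem Admissible.paramM_mul_paramV (h : Admissible A B) :
    paramM A B * paramV A B - paramU A B = B := by
  have hA := h.div_four_lt
  have hne : 4 * A - B ≠ 0 := by linarith
  have hM : (A - B / 4) * ((2 * B + 4 * √(A * B)) / (4 * A - B)) = (2 * B + 4 * √(A * B)) / 4 := by
    rw [← mul_div_assoc, div_eq_iff hne]
    ring
  rw [paramU, paramV, paramM, hM]
  ring

/-- The relation behind the choice of `U`, `V` and `M`: up to the positive factor `1 + V x`, the
function `g` is the perturbed entropy minus its maximum. -/
theorem Admissible.gFun_mul (h : Admissible A B) {x : ℝ} (hx : 0 ≤ x) :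
    gFun (paramU A B) (paramV A B) (paramM A B) x * (1 + paramV A B * x) =
      perturbedEntropy B x - A := by
  have hV := h.paramV_pos
  have hpos : 1 + paramV A B * x ≠ 0 := by positivity
  rw [gFun, perturbedEntropy, add_mul, div_mul_cancel₀ _ hpos]
  have h1 := h.paramU_mul_paramV
  have h2 := h.paramM_mul_paramV
  have h3 : paramM A B = A - B / 4 := rfl
  linear_combination x ^ 2 * h1 - x * h2 - h3

theorem Admissible.gFun_nonpos (h : Admissible A B) {x : ℝ} (hx : x ∈ Icc (0 : ℝ) 1) :
    gFun (paramU A B) (paramV A B) (paramM A B) x ≤ 0 := by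
  have hpos : 0 < 1 + paramV A B * x := by nlinarith [h.paramV_pos, hx.1]
  have h1 := h.gFun_mul hx.1
  have h2 := h.le hx
  by_contra! hg
  linarith [mul_pos hg hpos]

theorem Admissible.gFun_eq_zero (h : Admissible A B) {x : ℝ} (hx : 0 ≤ x)
    (hxA : perturbedEntropy B x = A) : gFun (paramU A B) (paramV A B) (paramM A B) x = 0 := by
  have hpos : 0 < 1 + paramV A B * x := by nlinarith [h.paramV_pos]
  have h1 := h.gFun_mul hx
  rw [hxA, sub_self] at h1
  exact (mul_eq_zero.1 h1).resolve_right hpos.ne'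

theorem Admissible.lam_eq (h : Admissible A B) (L : ℝ) :
    L * paramV A B / B = L / paramU A B := by
  have hU := h.paramU_pos
  have hV := h.paramV_pos
  have hB : B ≠ 0 := by linarith [h.1]
  rw [div_eq_div_iff hB hU.ne', mul_assoc, mul_comm (paramV A B), h.paramU_mul_paramV]

/-- With the chosen potentials, `f` differs from `g` by a constant. -/
theorem Admissible.fFun_eq (h : Admissible A B) {ℓa ℓb : ℕ} {lam : ℝ}
    (hL : 0 < Real.log ((ℓa : ℝ) / ℓb))
    (hlam : lam = Real.log ((ℓa : ℝ) / ℓb) * paramV A B / B) (x : ℝ) :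
    fFun ℓa ℓb lam (1 + paramV A B) 1 x =
      gFun (paramU A B) (paramV A B) (paramM A B) x + (paramM A B + 1 / lam * Real.log ℓb) := by
  have hU := h.paramU_pos
  have hLlam : 1 / lam * Real.log ((ℓa : ℝ) / ℓb) = paramU A B := by
    rw [hlam, h.lam_eq]
    field_simp
  rw [fFun, gFun, ← hLlam, show (1 + paramV A B) * x + 1 * (1 - x) = 1 + paramV A B * x by ring]
  ring

end Parameters

/-! ### The functional on the invariant measures of the example -/

section Example

variable {ℓa ℓb : ℕ}

theorem sum_alphabetMap (F : Bool → ℝ) :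
    ∑ i, F (alphabetMap ℓa ℓb i) = ℓa * F true + ℓb * F false := by
  rw [Fin.sum_univ_add]
  simp [alphabetMap]

theorem sum_filter_alphabetMap (F : Bool → ℝ) (b : Bool) :
    ∑ i with alphabetMap ℓa ℓb i = b, F (alphabetMap ℓa ℓb i) = (if b then ℓa else ℓb) * F b := by
  rw [Finset.sum_filter, sum_alphabetMap fun b' => if b' = b then F b' else 0]
  cases b <;> simp

/-- The frequency `μ(π⁻¹[a])` of the symbol `a`. -/
noncomputable def freq (ℓa ℓb : ℕ) (μ : Measure (ℕ → Fin (ℓa + ℓb))) : ℝ :=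
  μ.real ((fun x => alphabetMap ℓa ℓb (x 0)) ⁻¹' {true})

theorem measurable_alphabetMap_apply_zero :
    Measurable fun x : ℕ → Fin (ℓa + ℓb) => alphabetMap ℓa ℓb (x 0) :=
  (measurable_of_finite (alphabetMap ℓa ℓb)).comp (measurable_pi_apply 0)

variable (μ : Measure (ℕ → Fin (ℓa + ℓb))) [IsProbabilityMeasure μ]

theorem freq_mem_Icc : freq ℓa ℓb μ ∈ Icc (0 : ℝ) 1 :=
  ⟨measureReal_nonneg, measureReal_le_one⟩

theorem integral_alphabetMap (F : Bool → ℝ) :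
    ∫ x, F (alphabetMap ℓa ℓb (x 0)) ∂μ =
      freq ℓa ℓb μ * F true + (1 - freq ℓa ℓb μ) * F false := by
  have hm := measurable_alphabetMap_apply_zero (ℓa := ℓa) (ℓb := ℓb)
  have hsum := sum_measureReal_preimage μ hm
  rw [← sum_measureReal_preimage_mul μ hm F, Fintype.sum_bool]
  rw [Fintype.sum_bool] at hsum
  rw [freq, ← hsum, add_sub_cancel_left]

theorem integral_psi (ψa ψb : ℝ) :
    ∫ x, psi ψa ψb (factorMap ℓa ℓb x) ∂μ =
      ψa * freq ℓa ℓb μ + ψb * (1 - freq ℓa ℓb μ) :=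
  (integral_alphabetMap μ fun b => if b = true then ψa else ψb).trans (by simp; ring)

theorem integral_phi (lam : ℝ) : ∫ x, phi ℓa ℓb lam x ∂μ = lam := by
  simp [phi]

variable {μ}

theorem measureEntropy_factor_le (hμ : MeasurePreserving shift μ μ) :
    measureEntropy (μ.map (factorMap ℓa ℓb)) shift ≤
      ENNReal.ofReal (Real.binEntropy (freq ℓa ℓb μ)) := by
  have hp := measurable_oneBlock (alphabetMap ℓa ℓb)
  have : IsProbabilityMeasure (μ.map (oneBlock (alphabetMap ℓa ℓb))) :=
    Measure.isProbabilityMeasure_map hp.aemeasurable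
  refine (measureEntropy_le_entropyOf (measurePreserving_shift_map_oneBlock hμ _)).trans_eq ?_
  rw [entropyOf_map μ hp (measurable_pi_apply 0)]
  exact congrArg ENNReal.ofReal (entropyOf_bool μ measurable_alphabetMap_apply_zero)

theorem measureEntropy_le_factor_add (ha : 0 < ℓa) (hb : 0 < ℓb)
    (hμ : MeasurePreserving shift μ μ) :
    measureEntropy μ shift ≤ measureEntropy (μ.map (factorMap ℓa ℓb)) shift +
      ENNReal.ofReal (Real.log ((ℓa : ℝ) / ℓb) * freq ℓa ℓb μ + Real.log ℓb) := by
  have ha' : (0 : ℝ) < ℓa := by exact_mod_cast ha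
  have hb' : (0 : ℝ) < ℓb := by exact_mod_cast hb
  -- the weight of a symbol is the cardinality of its fibre
  have h := measureEntropy_le_map_add hμ (alphabetMap ℓa ℓb)
    (c := fun i => if alphabetMap ℓa ℓb i then (ℓa : ℝ) else ℓb)
    (fun i => by split_ifs <;> assumption) (fun b => ?_)
  · refine h.trans_eq ?_
    have hint := integral_alphabetMap μ fun b => Real.log (if b = true then (ℓa : ℝ) else ℓb)
    rw [hint]
    congr 2
    rw [Real.log_div ha'.ne' hb'.ne']
    simp only [if_true, Bool.false_eq_true, if_false]
    ring
  · rw [sum_filter_alphabetMap (fun b => (if b = true then (ℓa : ℝ) else ℓb)⁻¹) b]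
    cases b <;> simp [ha'.ne', hb'.ne']

/-- The functional is bounded by the value of `f` at the frequency of `a`. -/
theorem functional_le_fFun (ha : 0 < ℓa) (hb : 0 < ℓb) {lam ψa ψb : ℝ}
    (hlam : 0 < lam) (hψa : 0 < ψa) (hψb : 0 < ψb) (hμ : MeasurePreserving shift μ μ) :
    functional (factorMap ℓa ℓb) (phi ℓa ℓb lam) (psi ψa ψb) μ ≤
      fFun ℓa ℓb lam ψa ψb (freq ℓa ℓb μ) := by
  have ht := freq_mem_Icc μ
  have ha' : (ℓa : ℝ) ≠ 0 := by exact_mod_cast ha.ne'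
  have hb' : (ℓb : ℝ) ≠ 0 := by exact_mod_cast hb.ne'
  have hc : 0 ≤ Real.log ((ℓa : ℝ) / ℓb) * freq ℓa ℓb μ + Real.log ℓb := by
    rw [Real.log_div ha' hb']
    have h1 := mul_nonneg ht.1 (Real.log_nonneg (x := ℓa) (by exact_mod_cast ha))
    have h2 := mul_nonneg (sub_nonneg.2 ht.2) (Real.log_nonneg (x := ℓb) (by exact_mod_cast hb))
    linarith
  have hI : 0 < ψa * freq ℓa ℓb μ + ψb * (1 - freq ℓa ℓb μ) := by
    rcases ht.1.eq_or_lt with h | h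
    · rw [← h]
      linarith
    · nlinarith [mul_pos hψa h, mul_nonneg hψb.le (sub_nonneg.2 ht.2)]
  have h1 := measureEntropy_factor_le hμ
  have h2 := measureEntropy_le_factor_add ha hb hμ
  have hfin : measureEntropy (μ.map (factorMap ℓa ℓb)) shift ≠ ⊤ :=
    ne_top_of_le_ne_top ENNReal.ofReal_ne_top h1
  have h1' := ENNReal.toReal_mono ENNReal.ofReal_ne_top h1
  have h2' := ENNReal.toReal_mono (ENNReal.add_ne_top.2 ⟨hfin, ENNReal.ofReal_ne_top⟩) h2
  rw [ENNReal.toReal_ofReal (Real.binEntropy_nonneg ht.1 ht.2)] at h1'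
  rw [ENNReal.toReal_add hfin ENNReal.ofReal_ne_top, ENNReal.toReal_ofReal hc] at h2'
  rw [functional, integral_psi, integral_phi, fFun, one_div, inv_mul_eq_div]
  gcongr
  linarith

/-- The equidistributed law on the symbols, given the probability `x` of `a`. -/
theorem exists_symbolLaw (ha : 0 < ℓa) (hb : 0 < ℓb) {x : ℝ} (hx : x ∈ Icc (0 : ℝ) 1) :
    ∃ q : ProbabilityMeasure (Fin (ℓa + ℓb)), ∀ i, (q : Measure (Fin (ℓa + ℓb))).real {i} =
      if alphabetMap ℓa ℓb i = true then x / ℓa else (1 - x) / ℓb := by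
  have ha' : (ℓa : ℝ) ≠ 0 := by exact_mod_cast ha.ne'
  have hb' : (ℓb : ℝ) ≠ 0 := by exact_mod_cast hb.ne'
  let F : Bool → ℝ := fun b => if b = true then x / ℓa else (1 - x) / ℓb
  have hF : ∀ b, 0 ≤ F b := by
    intro b
    have := sub_nonneg.2 hx.2
    have := hx.1
    cases b <;> simp only [F] <;> positivity
  let w : PMF (Fin (ℓa + ℓb)) := PMF.ofFintype
    (fun i => ENNReal.ofReal (F (alphabetMap ℓa ℓb i))) (by
      rw [← ENNReal.ofReal_sum_of_nonneg fun i _ => hF _, sum_alphabetMap]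
      simp only [F, if_true, Bool.false_eq_true, if_false]
      rw [mul_div_cancel₀ _ ha', mul_div_cancel₀ _ hb']
      simp)
  refine ⟨⟨w.toMeasure, inferInstance⟩, fun i => ?_⟩
  change (w.toMeasure {i}).toReal = _
  rw [PMF.toMeasure_apply_singleton _ _ (measurableSet_singleton i)]
  exact ENNReal.toReal_ofReal (hF _)

/-- Among the invariant measures for which `a` has frequency `x`, the Bernoulli measure with
equidistributed symbols attains the value `f(x)`. -/
theorem exists_isBernoulli_functional_eq (ha : 0 < ℓa) (hb : 0 < ℓb) (lam ψa ψb : ℝ) {x : ℝ}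
    (hx : x ∈ Icc (0 : ℝ) 1) :
    ∃ μ ∈ invariantMeasures (Fin (ℓa + ℓb)), IsBernoulli μ ∧ freq ℓa ℓb μ = x ∧
      functional (factorMap ℓa ℓb) (phi ℓa ℓb lam) (psi ψa ψb) μ = fFun ℓa ℓb lam ψa ψb x := by
  have ha' : (0 : ℝ) < ℓa := by exact_mod_cast ha
  have hb' : (0 : ℝ) < ℓb := by exact_mod_cast hb
  obtain ⟨q, hq⟩ := exists_symbolLaw ha hb hx
  have hp := measurable_of_finite (alphabetMap ℓa ℓb)
  set q' := (q : Measure (Fin (ℓa + ℓb)))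
  set μ := Measure.infinitePi fun _ : ℕ => q' with hμ
  have hqp : IsProbabilityMeasure (q'.map (alphabetMap ℓa ℓb)) :=
    Measure.isProbabilityMeasure_map hp.aemeasurable
  have hfac : μ.map (factorMap ℓa ℓb) =
      Measure.infinitePi fun _ : ℕ => q'.map (alphabetMap ℓa ℓb) :=
    Measure.infinitePi_map_pi _ fun _ => hp
  have hlaw : ∀ b, (q'.map (alphabetMap ℓa ℓb)).real {b} = if b = true then x else 1 - x := by
    intro b
    have h := measureReal_preimage_comp q' measurable_id (alphabetMap ℓa ℓb) b
    simp only [Function.comp_id, preimage_id_eq, id] at h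
    rw [map_measureReal_apply hp (measurableSet_singleton b), h,
      Finset.sum_congr rfl fun i _ => hq i,
      sum_filter_alphabetMap fun b => if b = true then x / ℓa else (1 - x) / ℓb]
    cases b <;> simp <;> field_simp
  have hfreq : freq ℓa ℓb μ = x := by
    have h := hlaw true
    rw [map_measureReal_apply hp (measurableSet_singleton _),
      ← Measure.infinitePi_map_eval (fun _ : ℕ => q') 0,
      map_measureReal_apply (measurable_pi_apply 0) (hp (measurableSet_singleton _))] at h
    exact h
  have hbin := Real.binEntropy_nonneg hx.1 hx.2
  have hentY : measureEntropy (μ.map (factorMap ℓa ℓb)) shift =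
      ENNReal.ofReal (Real.binEntropy x) := by
    rw [hfac, measureEntropy_infinitePi, Fintype.sum_bool, hlaw, hlaw,
      Real.binEntropy_eq_negMulLog_add_negMulLog_one_sub]
    simp
  have hdiv : ∀ y l : ℝ, 0 < l →
      l * Real.negMulLog (y / l) = Real.negMulLog y + y * Real.log l := by
    intro y l hl
    have : Real.negMulLog l⁻¹ = l⁻¹ * Real.log l := by
      rw [Real.negMulLog, Real.log_inv]
      ring
    rw [div_eq_mul_inv, Real.negMulLog_mul, this]
    field_simp
  have hentX : measureEntropy μ shift = ENNReal.ofReal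
      (Real.binEntropy x + (x * Real.log ℓa + (1 - x) * Real.log ℓb)) := by
    rw [hμ, measureEntropy_infinitePi, Finset.sum_congr rfl fun i _ => congrArg _ (hq i),
      sum_alphabetMap fun b => Real.negMulLog (if b = true then x / ℓa else (1 - x) / ℓb)]
    simp only [if_true, Bool.false_eq_true, if_false]
    rw [hdiv _ _ ha', hdiv _ _ hb', Real.binEntropy_eq_negMulLog_add_negMulLog_one_sub]
    congr 1
    ring
  have hnonneg : 0 ≤ x * Real.log ℓa + (1 - x) * Real.log ℓb :=
    add_nonneg (mul_nonneg hx.1 (Real.log_nonneg (by exact_mod_cast ha)))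
      (mul_nonneg (sub_nonneg.2 hx.2) (Real.log_nonneg (by exact_mod_cast hb)))
  refine ⟨μ, ⟨inferInstance, measurePreserving_shift_infinitePi q'⟩, ⟨q, rfl⟩, hfreq, ?_⟩
  rw [functional, integral_psi, integral_phi, hfreq, hentX, hentY, ENNReal.toReal_ofReal hbin,
    ENNReal.toReal_ofReal (add_nonneg hbin hnonneg), fFun, Real.log_div ha'.ne' hb'.ne']
  ring

/-- If `f` has two maximizers in `[0, 1]`, the pressure is attained at the corresponding Bernoulli
measures. -/
theorem attainedAtTwoBernoulli_of_isMaxOn (ha : 0 < ℓa) (hb : 0 < ℓb)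
    {lam ψa ψb : ℝ} (hlam : 0 < lam) (hψa : 0 < ψa) (hψb : 0 < ψb) {x₁ x₂ : ℝ}
    (hx₁ : x₁ ∈ Icc (0 : ℝ) 1) (hx₂ : x₂ ∈ Icc (0 : ℝ) 1) (hne : x₁ ≠ x₂)
    (hmax₁ : IsMaxOn (fFun ℓa ℓb lam ψa ψb) (Icc 0 1) x₁)
    (hmax₂ : IsMaxOn (fFun ℓa ℓb lam ψa ψb) (Icc 0 1) x₂) :
    AttainedAtTwoBernoulli (factorMap ℓa ℓb) (phi ℓa ℓb lam) (psi ψa ψb) := by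
  have hub : ∀ {x}, IsMaxOn (fFun ℓa ℓb lam ψa ψb) (Icc 0 1) x → fFun ℓa ℓb lam ψa ψb x ∈
      upperBounds (functional (factorMap ℓa ℓb) (phi ℓa ℓb lam) (psi ψa ψb) ''
        invariantMeasures (Fin (ℓa + ℓb))) := by
    rintro x hx _ ⟨μ, ⟨_, hμ⟩, rfl⟩
    exact (functional_le_fFun ha hb hlam hψa hψb hμ).trans (hx (freq_mem_Icc μ))
  obtain ⟨μ₁, hμ₁, hB₁, hf₁, hF₁⟩ := exists_isBernoulli_functional_eq ha hb lam ψa ψb hx₁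
  obtain ⟨μ₂, hμ₂, hB₂, hf₂, hF₂⟩ := exists_isBernoulli_functional_eq ha hb lam ψa ψb hx₂
  refine ⟨⟨_, hub hmax₁⟩, μ₁, hμ₁, μ₂, hμ₂, ?_, hB₁, hB₂, ?_, ?_⟩
  · rintro rfl
    exact hne (hf₁.symm.trans hf₂)
  · exact (IsGreatest.csSup_eq ⟨mem_image_of_mem _ hμ₁, hF₁ ▸ hub hmax₁⟩).symm
  · exact (IsGreatest.csSup_eq ⟨mem_image_of_mem _ hμ₂, hF₂ ▸ hub hmax₂⟩).symm

end Example

/-! ### Two maximizing Bernoulli measures -/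

section TwoMaximizers

variable {A B : ℝ}

theorem Admissible.conclusion (h : Admissible A B) {ℓa ℓb : ℕ} (ha : 0 < ℓa) (hb : 0 < ℓb)
    (hL : (1 + paramV A B) / paramV A B * B < Real.log ((ℓa : ℝ) / ℓb)) :
    Conclusion A B ℓa ℓb (Real.log ((ℓa : ℝ) / ℓb) * paramV A B / B) (1 + paramV A B) 1 := by
  have hB : 0 < B := by linarith [h.1]
  have hV := h.paramV_pos
  have hLpos : 0 < Real.log ((ℓa : ℝ) / ℓb) := lt_trans (by positivity) hL
  set lam := Real.log ((ℓa : ℝ) / ℓb) * paramV A B / B with hlam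
  -- the lower bound on `log (ℓa / ℓb)` says exactly that `φ` exceeds the larger value of `ψ`
  have hlamV : 1 + paramV A B < lam := by
    rw [hlam, lt_div_iff₀ hB]
    have := mul_lt_mul_of_pos_right hL hV
    rwa [mul_right_comm, div_mul_cancel₀ _ hV.ne'] at this
  have hlam0 : 0 < lam := by linarith
  obtain ⟨x, hx, hx2, hxA⟩ := h.exists_eq
  have hx' : 1 - x ∈ Icc (0 : ℝ) 1 := ⟨sub_nonneg.2 hx.2, by linarith [hx.1]⟩
  have hne : x ≠ 1 - x := fun he => hx2 (by linarith)
  have hg₁ := h.gFun_eq_zero hx.1 hxA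
  have hg₂ := h.gFun_eq_zero hx'.1 ((perturbedEntropy_one_sub B x).trans hxA)
  have hmax : ∀ {y}, gFun (paramU A B) (paramV A B) (paramM A B) y = 0 →
      IsMaxOn (fFun ℓa ℓb lam (1 + paramV A B) 1) (Icc 0 1) y := by
    intro y hy z hz
    simp only [mem_ofPred_eq, h.fFun_eq hLpos hlam, hy]
    linarith [h.gFun_nonpos hz]
  refine ⟨hlam0, by linarith, one_pos, by linarith, fun y => ?_,
    ⟨fun y hy => h.gFun_nonpos hy, x, hx, 1 - x, hx', hne, hg₁, hg₂, hmax hg₁, hmax hg₂⟩,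
    attainedAtTwoBernoulli_of_isMaxOn ha hb hlam0 (by linarith) one_pos hx hx' hne
      (hmax hg₁) (hmax hg₂)⟩
  rw [psi, phi]
  split_ifs <;> linarith

/-- The bound is far from sharp: `(1 + V) B / V = √(AB) + B/2` is about `2.24`. -/
theorem bound_lt_log_150 {A B : ℝ} (hB : B = 3 * Real.log 2)
    (hA : A = Real.log 3 - 7 / 12 * Real.log 2) (h : Admissible A B) :
    (1 + paramV A B) / paramV A B * B < Real.log 150 := by
  have hV := h.paramV_pos
  have h4 : 0 < B := by linarith [h.1]
  have hle : (1 + paramV A B) / paramV A B * B = paramU A B + B := by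
    have h1 := h.paramU_mul_paramV
    rw [div_mul_eq_mul_div, div_eq_iff hV.ne']
    linear_combination -h1
  have hlog3 : Real.log 3 < 2 * Real.log 2 := by
    have := Real.log_lt_log (x := 3) (y := 2 ^ 2) (by norm_num) (by norm_num)
    rw [Real.log_pow] at this
    exact_mod_cast this
  have hlog150 : 7 * Real.log 2 < Real.log 150 := by
    have := Real.log_lt_log (x := 2 ^ 7) (y := 150) (by norm_num) (by norm_num)
    rw [Real.log_pow] at this
    exact_mod_cast this
  have hAB : A ≤ B := by linarith
  have hsqrt : √(A * B) ≤ B := Real.sqrt_le_iff.2 ⟨h4.le, by nlinarith⟩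
  rw [hle, paramU]
  linarith

end TwoMaximizers

end FullShift

theorem mainTheorem1 :
    (∀ (A B lam ψa ψb : ℝ) (ℓa ℓb : ℕ), 0 < ℓa → 0 < ℓb →
      FullShift.Admissible A B →
      (1 + FullShift.paramV A B) / FullShift.paramV A B * B < Real.log ((ℓa : ℝ) / ℓb) →
      ψa = 1 + FullShift.paramV A B → ψb = 1 →
      lam = Real.log ((ℓa : ℝ) / ℓb) * FullShift.paramV A B / B →
      lam = Real.log ((ℓa : ℝ) / ℓb) / FullShift.paramU A B ∧
      FullShift.Conclusion A B ℓa ℓb lam ψa ψb) ∧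
    (∀ (A B lam ψa ψb : ℝ),
      B = 3 * Real.log 2 → A = Real.log 3 - 7 / 12 * Real.log 2 →
      ψa = 1 + FullShift.paramV A B → ψb = 1 →
      lam = Real.log 150 * FullShift.paramV A B / B →
      FullShift.Admissible A B ∧
      B * ((1 / 3 : ℝ) - 1 / 2) ^ 2 + Real.binEntropy (1 / 3) = A ∧
      (1 + FullShift.paramV A B) / FullShift.paramV A B * B < Real.log 150 ∧
      FullShift.Conclusion A B 150 1 lam ψa ψb) := by
  refine ⟨?_, ?_⟩
  · rintro A B _ _ _ ℓa ℓb ha hb h hL rfl rfl rfl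
    exact ⟨h.lam_eq _, h.conclusion ha hb hL⟩
  · rintro A B _ _ _ hB hA rfl rfl rfl
    have h : FullShift.Admissible A B := by
      rw [hA, hB]
      exact FullShift.admissible_three_mul_log_two
    have hbound := FullShift.bound_lt_log_150 hB hA h
    have h150 : Real.log ((150 : ℕ) / (1 : ℕ) : ℝ) = Real.log 150 := by norm_num
    refine ⟨h, ?_, hbound, ?_⟩
    · rw [hA, hB]
      exact FullShift.perturbedEntropy_third
    · have := h.conclusion (ℓa := 150) (ℓb := 1) (by norm_num) one_pos (by rwa [h150])
      rwa [h150] at this
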